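/- **Theorem.** Let $k$ be an algebraically closed field, let $Q$ be a finite quiver without oriented cycles, and let $kQ$ be its path algebra. Let $M$ be a finitely generated (equivalently, finite-dimensional) $kQ$-module which is rigid, i.e. $\operatorname{Ext}^1_{kQ}(M,M)=0$. 1. Let $0\to P'\xrightarrow{\,p\,}P\to M\to 0$ be an exact sequence of $kQ$-modules with $P'$ and $P$ finitely generated projective. Then there is a Zariski open neighbourhood $U$ of $p$ in the finite-dimensional $k$-vector space $\operatorname{Hom}_{kQ}(P',P)$ such that every $f\in U$ is a monomorphism with $\operatorname{coker} f\cong M$ as $kQ$-modules. 2. Almost all modules with the same dimension vector as $M$ are isomorphic to $M$: let $d_i=\dim_k e_iM$ for each vertex $i$, where $e_i\in kQ$ is the path of length zero at $i$. In the affine space $\operatorname{Rep}(Q,d)=\prod_{a:i\to j}\operatorname{Hom}_k(k^{d_i},k^{d_j})$, the product being over all arrows $a$ of $Q$, there is a dense Zariski open subset all of whose points, viewed as $kQ$-modules, are isomorphic to $M$. -/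

import Mathlib

open scoped Topology

universe u v a r w

/-! ### Path algebras -/

/-- The path algebra of a quiver `V` over `k`: the `k`-vector space with basis all paths of `V`
(including the path of length zero at each vertex). A basis element is `⟨a, b, p⟩` with `p` a path
from `a` to `b`. -/
def PathAlgebra (k V : Type*) [Quiver V] [Field k] : Type _ :=
  (Σ a b : V, Quiver.Path a b) →₀ k

namespace PathAlgebra

section Basic

variable (k : Type*) {V : Type*} [Quiver V] [Field k]

noncomputable instance instAddCommGroup : AddCommGroup (PathAlgebra k V) :=
  inferInstanceAs (AddCommGroup ((Σ a b : V, Quiver.Path a b) →₀ k))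

noncomputable instance instModule : Module k (PathAlgebra k V) :=
  inferInstanceAs (Module k ((Σ a b : V, Quiver.Path a b) →₀ k))

/-- The basis of the path algebra given by the paths. -/
noncomputable def basis : Module.Basis (Σ a b : V, Quiver.Path a b) k (PathAlgebra k V) :=
  Finsupp.basisSingleOne

/-- The element of the path algebra given by a path. -/
noncomputable def ofPath {a b : V} (p : Quiver.Path a b) : PathAlgebra k V :=
  basis k ⟨a, b, p⟩

variable {k}

/-- Two linear maps on the path algebra that agree on all paths are equal. -/
theorem linearMap_ext {M : Type*} [AddCommMonoid M] [Module k M] {f g : PathAlgebra k V →ₗ[k] M}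
    (h : ∀ (a b : V) (p : Quiver.Path a b), f (ofPath k p) = g (ofPath k p)) : f = g :=
  (basis k).ext fun ⟨a, b, p⟩ => h a b p

variable (k)

/-- The idempotent `e_i` of the path algebra at a vertex `i`: the path of length zero. -/
noncomputable def vertex (i : V) : PathAlgebra k V := ofPath k (Quiver.Path.nil : Quiver.Path i i)

noncomputable instance instOne [Fintype V] : One (PathAlgebra k V) := ⟨∑ i : V, vertex k i⟩

theorem one_def [Fintype V] : (1 : PathAlgebra k V) = ∑ i : V, vertex k i := rfl

variable [DecidableEq V]

/-- The product `q * p` of two paths: the path "first `p`, then `q`" if `q` starts where `p` ends,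
and zero otherwise. With this convention left modules over the path algebra are the
representations of the quiver. -/
noncomputable def pathMul {c d a b : V} (q : Quiver.Path c d) (p : Quiver.Path a b) :
    PathAlgebra k V :=
  if h : b = c then ofPath k ((p.cast rfl h).comp q) else 0

/-- Multiplication of the path algebra, the bilinear extension of the product of paths. -/
noncomputable def mulLin : PathAlgebra k V →ₗ[k] PathAlgebra k V →ₗ[k] PathAlgebra k V :=
  (basis k).constr k fun q => (basis k).constr k fun p => pathMul k q.2.2 p.2.2

noncomputable instance instMul : Mul (PathAlgebra k V) := ⟨fun x y => mulLin k x y⟩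

theorem mul_def (x y : PathAlgebra k V) : x * y = mulLin k x y := rfl

theorem ofPath_mul {c d a b : V} (q : Quiver.Path c d) (p : Quiver.Path a b) :
    ofPath k q * ofPath k p = pathMul k q p := by
  simp only [mul_def, mulLin, ofPath, Module.Basis.constr_basis]

theorem ofPath_mul_comp {a b c : V} (q : Quiver.Path b c) (p : Quiver.Path a b) :
    ofPath k q * ofPath k p = ofPath k (p.comp q) := by
  simp [ofPath_mul, pathMul]

theorem ofPath_mul_of_ne {c d a b : V} (q : Quiver.Path c d) (p : Quiver.Path a b) (h : b ≠ c) :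
    ofPath k q * ofPath k p = 0 := by
  simp [ofPath_mul, pathMul, h]

theorem mul_assoc_aux (x y z : PathAlgebra k V) : x * y * z = x * (y * z) := by
  have zl (w : PathAlgebra k V) : 0 * w = 0 := by simp [mul_def]
  have zr (w : PathAlgebra k V) : w * 0 = 0 := by simp [mul_def]
  suffices h : (mulLin k).flip z ∘ₗ (mulLin k).flip y = (mulLin k).flip (mulLin k y z) from
    LinearMap.congr_fun h x
  refine linearMap_ext fun c₁ d₁ r => ?_
  suffices h : (mulLin k).flip z ∘ₗ mulLin k (ofPath k r) =
      mulLin k (ofPath k r) ∘ₗ (mulLin k).flip z from LinearMap.congr_fun h y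
  refine linearMap_ext fun c₂ d₂ q => ?_
  suffices h : mulLin k (mulLin k (ofPath k r) (ofPath k q)) =
      mulLin k (ofPath k r) ∘ₗ mulLin k (ofPath k q) from LinearMap.congr_fun h z
  refine linearMap_ext fun c₃ d₃ p => ?_
  change ofPath k r * ofPath k q * ofPath k p = ofPath k r * (ofPath k q * ofPath k p)
  by_cases h₁ : d₂ = c₁
  · subst h₁
    by_cases h₂ : d₃ = c₂
    · subst h₂
      simp only [ofPath_mul_comp, Quiver.Path.comp_assoc]
    · rw [ofPath_mul_comp, ofPath_mul_of_ne _ _ _ h₂, ofPath_mul_of_ne _ _ _ h₂, zr]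
  · rw [ofPath_mul_of_ne _ _ _ h₁, zl]
    by_cases h₂ : d₃ = c₂
    · subst h₂
      rw [ofPath_mul_comp, ofPath_mul_of_ne _ _ _ h₁]
    · rw [ofPath_mul_of_ne _ _ _ h₂, zr]

variable [Fintype V]

theorem one_mul_aux (x : PathAlgebra k V) : 1 * x = x := by
  suffices h : mulLin k (1 : PathAlgebra k V) = LinearMap.id from LinearMap.congr_fun h x
  refine linearMap_ext fun a b p => ?_
  rw [one_def, map_sum, LinearMap.sum_apply, Finset.sum_eq_single b]
  · rw [← mul_def, vertex, ofPath_mul_comp]; rfl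
  · intro c _ hc
    rw [← mul_def, vertex, ofPath_mul_of_ne _ _ _ hc.symm]
  · simp

theorem mul_one_aux (x : PathAlgebra k V) : x * 1 = x := by
  suffices h : (mulLin k).flip (1 : PathAlgebra k V) = LinearMap.id from LinearMap.congr_fun h x
  refine linearMap_ext fun a b p => ?_
  rw [one_def, map_sum, LinearMap.sum_apply, Finset.sum_eq_single a]
  · rw [LinearMap.flip_apply, ← mul_def, vertex, ofPath_mul_comp, Quiver.Path.nil_comp]; rfl
  · intro c _ hc
    rw [LinearMap.flip_apply, ← mul_def, vertex, ofPath_mul_of_ne _ _ _ hc]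
  · simp

noncomputable instance instRing : Ring (PathAlgebra k V) where
  __ := instAddCommGroup k
  mul_assoc := mul_assoc_aux k
  one_mul := one_mul_aux k
  mul_one := mul_one_aux k
  left_distrib x y z := by simp [mul_def]
  right_distrib x y z := by simp [mul_def]
  zero_mul x := by simp [mul_def]
  mul_zero x := by simp [mul_def]

noncomputable instance instAlgebra : Algebra k (PathAlgebra k V) :=
  Algebra.ofModule (fun r x y => by simp [mul_def]) (fun r x y => by simp [mul_def])

end Basic

end PathAlgebra

/-- A quiver is acyclic if it has no oriented cycles: every path from a vertex to itself has
length zero. -/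
def Quiver.NoOrientedCycles (V : Type*) [Quiver V] : Prop :=
  ∀ (a : V) (p : Quiver.Path a a), p.length = 0

/-- The dimension vector of a left module `M` over the path algebra:
its value at the vertex `i` is the dimension of `e_i M`. -/
noncomputable def dimVector (k : Type*) {V : Type*} [Quiver V] [Field k] [DecidableEq V] [Fintype V]
    (M : Type*) [AddCommGroup M] [Module k M] [Module (PathAlgebra k V) M]
    [IsScalarTower k (PathAlgebra k V) M] (i : V) : ℕ :=
  Module.finrank k (LinearMap.range (Algebra.lsmul k k M (PathAlgebra.vertex k i)))

/-- A module over a ring is rigid if it has no self-extensions, i.e. `Ext¹(M, M) = 0`. -/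
def IsRigidModule (A : Type r) [Ring A] [Small.{w} A] (M : Type w) [AddCommGroup M]
    [Module A M] : Prop :=
  Subsingleton (CategoryTheory.Abelian.Ext.{w} (ModuleCat.of A M) (ModuleCat.of A M) 1)

/-! ### Representation spaces -/

/-- The representation space `Rep(V, d)`: a point consists of a linear map `k^{d i} → k^{d j}` for
every arrow `i ⟶ j`. -/
abbrev RepSpace (k V : Type*) [Quiver V] [Field k] (d : V → ℕ) : Type _ :=
  ∀ i j : V, (i ⟶ j) → ((Fin (d i) → k) →ₗ[k] (Fin (d j) → k))

namespace RepSpace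

section Total

variable {k V : Type*} [Quiver V] [Field k] {d : V → ℕ}

/-- The linear map by which a path acts in a representation. -/
def mapPath (R : RepSpace k V d) {i : V} :
    ∀ {j : V}, Quiver.Path i j → ((Fin (d i) → k) →ₗ[k] (Fin (d j) → k))
  | _, Quiver.Path.nil => LinearMap.id
  | _, Quiver.Path.cons p a => R _ _ a ∘ₗ mapPath R p

theorem mapPath_comp (R : RepSpace k V d) {i j l : V} (p : Quiver.Path i j) (q : Quiver.Path j l) :
    R.mapPath (p.comp q) = R.mapPath q ∘ₗ R.mapPath p := by
  induction q with
  | nil => rfl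
  | cons q a ih => simp [mapPath, ih, LinearMap.comp_assoc]

variable [DecidableEq V]

/-- The endomorphism of `⨁ i, k^{d i}` by which a path from `i` to `j` acts: it is the map
`k^{d i} → k^{d j}` of the representation on the `i`-th summand, and zero on the others. -/
def pathEnd (R : RepSpace k V d) {i j : V} (p : Quiver.Path i j) :
    Module.End k (∀ i : V, Fin (d i) → k) :=
  LinearMap.single k (fun i => Fin (d i) → k) j ∘ₗ R.mapPath p ∘ₗ LinearMap.proj i

theorem pathEnd_mul_comp (R : RepSpace k V d) {i j l : V} (q : Quiver.Path j l)
    (p : Quiver.Path i j) : R.pathEnd q * R.pathEnd p = R.pathEnd (p.comp q) := by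
  ext1 x
  simp [pathEnd, mapPath_comp]

theorem pathEnd_mul_of_ne (R : RepSpace k V d) {a b i j : V} (q : Quiver.Path a b)
    (p : Quiver.Path i j) (h : j ≠ a) : R.pathEnd q * R.pathEnd p = 0 := by
  ext1 x
  simp [pathEnd, h.symm]

variable [Fintype V]

/-- The action of the path algebra on `⨁ i, k^{d i}` given by a representation. -/
noncomputable def action (R : RepSpace k V d) :
    PathAlgebra k V →ₐ[k] Module.End k (∀ i : V, Fin (d i) → k) :=
  AlgHom.ofLinearMap ((PathAlgebra.basis k).constr k fun p => R.pathEnd p.2.2)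
    (by
      rw [PathAlgebra.one_def, map_sum]
      refine LinearMap.ext fun x => ?_
      simp only [PathAlgebra.vertex, PathAlgebra.ofPath, Module.Basis.constr_basis,
        LinearMap.sum_apply]
      exact LinearMap.sum_single_apply _ x)
    (by
      intro x y
      set F := (PathAlgebra.basis k).constr k fun p => R.pathEnd p.2.2 with hF
      have hof {i j : V} (p : Quiver.Path i j) : F (PathAlgebra.ofPath k p) = R.pathEnd p := by
        simp only [hF, PathAlgebra.ofPath, Module.Basis.constr_basis]
      suffices h : F ∘ₗ (PathAlgebra.mulLin k).flip y = LinearMap.mulRight k (F y) ∘ₗ F from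
        LinearMap.congr_fun h x
      refine PathAlgebra.linearMap_ext fun a b q => ?_
      suffices h : F ∘ₗ PathAlgebra.mulLin k (PathAlgebra.ofPath k q) =
        LinearMap.mulLeft k (F (PathAlgebra.ofPath k q)) ∘ₗ F from LinearMap.congr_fun h y
      refine PathAlgebra.linearMap_ext fun i j p => ?_
      change F (PathAlgebra.ofPath k q * PathAlgebra.ofPath k p) =
        F (PathAlgebra.ofPath k q) * F (PathAlgebra.ofPath k p)
      rw [hof, hof]
      by_cases h : j = a
      · subst h
        rw [PathAlgebra.ofPath_mul_comp, hof, pathEnd_mul_comp]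
      · rw [PathAlgebra.ofPath_mul_of_ne _ _ _ h, map_zero, pathEnd_mul_of_ne _ _ _ h])

end Total

/-- The left module over the path algebra given by a point `R` of the representation space: the
vector space `⨁ i, k^{d i}`, on which a path acts through the linear maps of its arrows. -/
def ModuleOf {k V : Type*} [Quiver V] [Field k] {d : V → ℕ} (_R : RepSpace k V d) : Type _ :=
  ∀ i : V, Fin (d i) → k

section ModuleOf

variable {k V : Type*} [Quiver V] [Field k] {d : V → ℕ} (R : RepSpace k V d)

noncomputable instance instAddCommGroupModuleOf : AddCommGroup R.ModuleOf :=
  inferInstanceAs (AddCommGroup (∀ i : V, Fin (d i) → k))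

noncomputable instance instModuleModuleOf [DecidableEq V] [Fintype V] :
    Module (PathAlgebra k V) R.ModuleOf :=
  Module.compHom (∀ i : V, Fin (d i) → k) R.action.toRingHom

end ModuleOf

end RepSpace

/-! ### The Zariski topology of a finite-dimensional vector space -/

/-- The algebra of polynomial functions on a vector space `W`: the algebra of functions `W → k`
generated by the linear forms. -/
def polyFunctions (k W : Type*) [Field k] [AddCommGroup W] [Module k W] :
    Subalgebra k (W → k) :=
  Algebra.adjoin k (Set.range fun φ : Module.Dual k W => (φ : W → k))

/-- The Zariski topology on a vector space `W`: a basis of the open sets is given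
by the sets `{w | f w ≠ 0}` with `f` a polynomial function. -/
@[reducible] def zariskiTopology (k W : Type*) [Field k] [AddCommGroup W] [Module k W] : TopologicalSpace W :=
  TopologicalSpace.generateFrom {U | ∃ f ∈ polyFunctions k W, U = {w | f w ≠ 0}}

/-!
Both parts say that the isomorphism type of a rigid module is an open condition, and both are proved
by deforming the identity of `M`, without orbit dimensions or tangent spaces.

An isomorphism between `M` and a nearby module is an invertible solution of a system of homogeneous
linear equations whose coefficients depend polynomially on the nearby module. For a homomorphism
`f : P' → P` near `p` the system is `a ∘ p = f ∘ b` with unknowns `a ∈ End P` and `b ∈ End P'`; for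
a representation `R` near the representation `R₀` of `M` it is `γ j ∘ R₀ α = R α ∘ γ i` for all
arrows `α : i ⟶ j`, with unknowns `γ i ∈ End (k^{d i})`. At the point given by `M` itself the identity is a
solution, and the cokernel of the system is `Ext¹(M, M)`: its equations are independent there
exactly because `M` is rigid (`IsRigidModule.exists_extension`, `IsRigidModule.exists_commutator`).

A solution of an independent system persists when the coefficients vary: by Cramer's rule there is
a solution which is a polynomial function of the parameters and which specializes to the identity
(`exists_polyFunction_kernel`). Its determinant is a polynomial function that is nonzero at
the given point, and the set where it is nonzero is the open set sought. Over an infinite field such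
a set is dense (`polyFunctions.dense`).

The systems live on finite-dimensional spaces because the path algebra of a finite quiver without
oriented cycles is finite-dimensional (`PathAlgebra.finite`), hence so are `P`, `P'` and `M`.
-/

/-! ### The Zariski topology -/

section Zariski
variable {k W E : Type*} [Field k] [AddCommGroup W] [Module k W] [AddCommGroup E] [Module k E]

theorem polyFunctions.linear (φ : Module.Dual k W) : (fun w => φ w) ∈ polyFunctions k W :=
  Algebra.subset_adjoin ⟨φ, rfl⟩

theorem polyFunctions.const (c : k) : (fun _ => c) ∈ polyFunctions k W :=
  (polyFunctions k W).algebraMap_mem c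

/-- Polynomial functions pull back along a map whose composites with all linear forms are
polynomial. -/
theorem polyFunctions.comp {F : W → E} (hF : ∀ φ : Module.Dual k E, (fun w => φ (F w)) ∈
    polyFunctions k W) {g : E → k} (hg : g ∈ polyFunctions k E) :
    (fun w => g (F w)) ∈ polyFunctions k W := by
  induction hg using Algebra.adjoin_induction with
  | mem g hg => obtain ⟨φ, rfl⟩ := hg; exact hF φ
  | algebraMap c => exact polyFunctions.const c
  | add x y _ _ hx hy => exact add_mem hx hy
  | mul x y _ _ hx hy => exact mul_mem hx hy

theorem polyFunctions.sum {ι : Type*} (s : Finset ι) {f : ι → W → k}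
    (hf : ∀ i ∈ s, f i ∈ polyFunctions k W) :
    (fun w => ∑ i ∈ s, f i w) ∈ polyFunctions k W := by
  convert sum_mem hf using 1
  ext w; simp

theorem polyFunctions.prod {ι : Type*} (s : Finset ι) {f : ι → W → k}
    (hf : ∀ i ∈ s, f i ∈ polyFunctions k W) :
    (fun w => ∏ i ∈ s, f i w) ∈ polyFunctions k W := by
  convert prod_mem hf using 1
  ext w; simp

theorem polyFunctions.det {n : Type*} [Fintype n] [DecidableEq n] {F : W → Matrix n n k}
    (hF : ∀ i j, (fun w => F w i j) ∈ polyFunctions k W) :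
    (fun w => (F w).det) ∈ polyFunctions k W := by
  simp only [Matrix.det_apply']
  exact polyFunctions.sum _ fun σ _ => mul_mem (polyFunctions.const _)
    (polyFunctions.prod _ fun i _ => hF _ _)

theorem polyFunctions.adjugate {n : Type*} [Fintype n] [DecidableEq n] {F : W → Matrix n n k}
    (hF : ∀ i j, (fun w => F w i j) ∈ polyFunctions k W) (i j : n) :
    (fun w => (F w).adjugate i j) ∈ polyFunctions k W := by
  simp only [Matrix.adjugate_apply]
  refine polyFunctions.det fun i' j' => ?_
  simp only [Matrix.updateRow_apply]
  split_ifs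
  · exact polyFunctions.const _
  · exact hF _ _

/-- The determinant of an endomorphism that depends linearly on a parameter. -/
theorem polyFunctions.linearMap_det [Module.Finite k E] (T : W →ₗ[k] Module.End k E) :
    (fun w => LinearMap.det (T w)) ∈ polyFunctions k W := by
  let b := Module.finBasis k E
  simp only [← LinearMap.det_toMatrix b]
  refine polyFunctions.det fun i j => ?_
  simp only [LinearMap.toMatrix_apply]
  exact polyFunctions.linear (b.coord i ∘ₗ LinearMap.applyₗ (b j) ∘ₗ T)

theorem polyFunctions.isOpen {h : W → k} (hh : h ∈ polyFunctions k W) :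
    IsOpen[zariskiTopology k W] {w : W | h w ≠ 0} :=
  TopologicalSpace.isOpen_generateFrom_of_mem ⟨h, hh, rfl⟩

/-- A polynomial function is a polynomial in one variable along every line. -/
theorem polyFunctions.exists_polynomial {f : W → k} (hf : f ∈ polyFunctions k W) (x y : W) :
    ∃ F : Polynomial k, ∀ t, F.eval t = f (x + t • y) := by
  induction hf using Algebra.adjoin_induction with
  | mem f hf =>
    obtain ⟨φ, rfl⟩ := hf
    exact ⟨.C (φ x) + .C (φ y) * .X, fun t => by simp [mul_comm (φ y) t]⟩
  | algebraMap c => exact ⟨.C c, fun t => by simp⟩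
  | add f g _ _ hf hg =>
    obtain ⟨F, hF⟩ := hf; obtain ⟨G, hG⟩ := hg
    exact ⟨F + G, fun t => by simp [hF, hG]⟩
  | mul f g _ _ hf hg =>
    obtain ⟨F, hF⟩ := hf; obtain ⟨G, hG⟩ := hg
    exact ⟨F * G, fun t => by simp [hF, hG]⟩

/-- Over an infinite field two nonzero polynomial functions are simultaneously nonzero at some
point, which can be found on the line through a point where the first is nonzero and a point where
the second is. -/
theorem polyFunctions.mul_ne_zero [Infinite k] {f g : W → k} (hf : f ∈ polyFunctions k W)
    (hg : g ∈ polyFunctions k W) {x y : W} (hx : f x ≠ 0) (hy : g y ≠ 0) :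
    ∃ z, f z ≠ 0 ∧ g z ≠ 0 := by
  obtain ⟨F, hF⟩ := polyFunctions.exists_polynomial hf x (y - x)
  obtain ⟨G, hG⟩ := polyFunctions.exists_polynomial hg x (y - x)
  have hF0 : F ≠ 0 := by rintro rfl; exact hx (by simpa using (hF 0).symm)
  have hG0 : G ≠ 0 := by rintro rfl; exact hy (by simpa using (hG 1).symm)
  by_contra! h
  refine _root_.mul_ne_zero hF0 hG0 (Polynomial.funext fun t => ?_)
  rw [Polynomial.eval_mul, hF, hG, Polynomial.eval_zero, mul_eq_zero, or_iff_not_imp_left]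
  exact h _

theorem polyFunctions.dense [Infinite k] {h : W → k} (hh : h ∈ polyFunctions k W) {p : W}
    (hp : h p ≠ 0) : @Dense _ (zariskiTopology k W) {w | h w ≠ 0} := by
  let := zariskiTopology k W
  have hb : TopologicalSpace.IsTopologicalBasis
      {U : Set W | ∃ f ∈ polyFunctions k W, U = {w | f w ≠ 0}} :=
    { exists_subset_inter := by
        rintro _ ⟨f, hf, rfl⟩ _ ⟨g, hg, rfl⟩ x hx
        exact ⟨_, ⟨f * g, mul_mem hf hg, rfl⟩, by simpa using hx, fun y hy => by simpa using hy⟩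
      sUnion_eq := Set.eq_univ_of_forall fun x =>
        ⟨_, ⟨1, one_mem _, rfl⟩, by simp⟩
      eq_generateFrom := rfl }
  rw [hb.dense_iff]
  rintro _ ⟨f, hf, rfl⟩ ⟨x, hx⟩
  exact polyFunctions.mul_ne_zero hf hh hx hp

/-! ### Solutions of a linear system with parameters -/

/-- Let a linear system `L w x = 0` depend polynomially on the parameter `w`. A solution `x₀` at a
parameter `p` where `L p` is surjective deforms to solutions at all parameters: there is a solution
that is a polynomial function of `w` and equals `x₀` at `p`. So an open condition `g x ≠ 0`
satisfied by `x₀` can be solved on a Zariski neighbourhood of `p`. -/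
theorem exists_polyFunction_kernel {H : Type*} [AddCommGroup H] [Module k H] [Module.Finite k H]
    (L : W → E →ₗ[k] H) (hL : ∀ x (φ : Module.Dual k H), (fun w => φ (L w x)) ∈ polyFunctions k W)
    {p : W} (hp : Function.Surjective (L p)) {x₀ : E} (hx₀ : L p x₀ = 0)
    {g : E → k} (hg : g ∈ polyFunctions k E) (hgx : g x₀ ≠ 0) :
    ∃ h ∈ polyFunctions k W, h p ≠ 0 ∧ ∀ w, h w ≠ 0 → ∃ x, L w x = 0 ∧ g x ≠ 0 := by
  obtain ⟨s, hs⟩ := (L p).exists_rightInverse_of_surjective (LinearMap.range_eq_top.2 hp)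
  let b := Module.finBasis k H
  let T : W → Matrix _ _ k := fun w => LinearMap.toMatrix b b (L w ∘ₗ s)
  have hT i j : (fun w => T w i j) ∈ polyFunctions k W := by
    simpa [T, LinearMap.toMatrix_apply] using hL (s (b j)) (b.coord i)
  -- Cramer's rule for `L w ∘ s`: with `D = det (L w ∘ s)`, the vector
  -- `x₀ - s ((L w ∘ s)⁻¹ (L w x₀))` is a solution, and multiplying it by `D` turns the inverse into
  -- the adjugate. The product is a solution even where `D` vanishes.
  let x : W → E := fun w => (T w).det • x₀ -
    s (Matrix.toLin b b (T w).adjugate (L w x₀))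
  have hx w : L w (x w) = 0 := by
    have h1 : L w ∘ₗ s = Matrix.toLin b b (T w) := by simp [T]
    have h2 : (L w ∘ₗ s) ∘ₗ Matrix.toLin b b (T w).adjugate =
        (T w).det • LinearMap.id := by
      rw [h1, ← Matrix.toLin_mul, Matrix.mul_adjugate, map_smul, Matrix.toLin_one]
    have h3 := LinearMap.congr_fun h2 (L w x₀)
    simp only [LinearMap.comp_apply, LinearMap.smul_apply, LinearMap.id_apply] at h3
    simp only [x, map_sub, map_smul, h3, sub_self]
  have hxp : x p = x₀ := by simp [x, hx₀, T, hs]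
  refine ⟨fun w => g (x w), polyFunctions.comp (fun φ => ?_) hg, by simpa [hxp] using hgx,
    fun w hw => ⟨x w, hx w, hw⟩⟩
  simp only [x, map_sub, map_smul, smul_eq_mul]
  refine sub_mem (mul_mem (polyFunctions.det hT) (polyFunctions.const _)) ?_
  simp only [Matrix.toLin_apply, map_sum, map_smul, smul_eq_mul, Matrix.mulVec, dotProduct]
  exact polyFunctions.sum _ fun i _ => mul_mem (polyFunctions.sum _ fun j _ =>
    mul_mem (polyFunctions.adjugate hT i j) (hL x₀ (b.coord j))) (polyFunctions.const _)

end Zariski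

/-! ### Rigid modules and cokernels of maps between projective modules -/

open CategoryTheory in
/-- `Ext¹(M, M) = 0` is used only in this form: if `0 → X → Y → M → 0` is exact, then every
homomorphism `X → M` extends to `Y`, by the long exact sequence for `Hom(-, M)`. -/
theorem IsRigidModule.exists_extension {A : Type r} [Ring A] [Small.{w} A] {M X Y : Type w}
    [AddCommGroup M] [Module A M] [AddCommGroup X] [Module A X] [AddCommGroup Y] [Module A Y]
    (hM : IsRigidModule A M) (i : X →ₗ[A] Y) (π : Y →ₗ[A] M) (hi : Function.Injective i)
    (hex : Function.Exact i π) (hπ : Function.Surjective π) (f : X →ₗ[A] M) :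
    ∃ g : Y →ₗ[A] M, g ∘ₗ i = f := by
  have hS : (ShortComplex.mk (ModuleCat.ofHom i) (ModuleCat.ofHom π)
      (by rw [← ModuleCat.ofHom_comp, hex.linearMap_comp_eq_zero]; rfl)).ShortExact :=
    { exact := (ShortComplex.ShortExact.moduleCat_exact_iff_function_exact _).2 hex
      mono_f := (ModuleCat.mono_iff_injective _).2 hi
      epi_g := (ModuleCat.epi_iff_surjective _).2 hπ }
  have : Subsingleton (Abelian.Ext.{w} (ModuleCat.of A M) (ModuleCat.of A M) 1) := hM
  -- The obstruction to extending `f` lies in `Ext¹(M, M)`.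
  obtain ⟨g, hg⟩ := Abelian.Ext.contravariant_sequence_exact₁ hS _
    (Abelian.Ext.mk₀ (ModuleCat.ofHom f)) (add_zero 1) (Subsingleton.elim _ _)
  obtain ⟨g, rfl⟩ := Abelian.Ext.mk₀_bijective _ _ |>.2 g
  rw [Abelian.Ext.mk₀_comp_mk₀] at hg
  have := (Abelian.Ext.mk₀_bijective _ _).1 hg
  exact ⟨g.hom, congrArg ModuleCat.Hom.hom this⟩

section
variable {k A : Type*} [Field k] [Ring A] [Algebra k A] {X Y : Type*}
    [AddCommGroup X] [Module k X] [Module A X] [IsScalarTower k A X] [Module.Finite k X]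
    [AddCommGroup Y] [Module k Y] [Module A Y] [IsScalarTower k A Y] [Module.Finite k Y]

theorem finite_linearMap_of_isScalarTower : Module.Finite k (X →ₗ[A] Y) :=
  Module.Finite.of_injective (LinearMap.restrictScalarsₗ k A X Y k)
    (LinearMap.restrictScalars_injective k)

theorem LinearMap.bijective_of_det_restrictScalars_ne_zero {f : X →ₗ[A] X}
    (hf : LinearMap.det (f.restrictScalars k) ≠ 0) :
    Function.Bijective f :=
  (LinearMap.equivOfDetNeZero (f.restrictScalars k) hf).bijective

end

/-- The first half of the theorem, over any algebra. A homomorphism `f` near `p`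
is shown to be conjugate to `p` by solving `a ∘ p = f ∘ b` for automorphisms `a` of `P` and `b` of
`P'`. At `f = p` the linear map `(a, b) ↦ a ∘ p - f ∘ b` is surjective because `Ext¹(M, M) = 0`. -/
theorem IsRigidModule.exists_isOpen_coker_equiv {k A : Type*} [Field k] [Ring A] [Algebra k A]
    [Small.{w} A] {P' P M : Type w}
    [AddCommGroup M] [Module A M]
    [AddCommGroup P'] [Module k P'] [Module A P'] [IsScalarTower k A P'] [Module.Finite k P']
    [AddCommGroup P] [Module k P] [Module A P] [IsScalarTower k A P] [Module.Finite k P]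
    [Module.Projective A P] [Module.Projective A P'] (hM : IsRigidModule A M)
    (p : P' →ₗ[A] P) (π : P →ₗ[A] M) (hp : Function.Injective p) (hex : Function.Exact p π)
    (hπ : Function.Surjective π) :
    ∃ U : Set (P' →ₗ[A] P), IsOpen[zariskiTopology k (P' →ₗ[A] P)] U ∧ p ∈ U ∧
        ∀ f ∈ U, Function.Injective f ∧ Nonempty ((P ⧸ LinearMap.range f) ≃ₗ[A] M) := by
  have : Module.Finite k (P' →ₗ[A] P) := finite_linearMap_of_isScalarTower
  let L (f : P' →ₗ[A] P) : ((P →ₗ[A] P) × (P' →ₗ[A] P')) →ₗ[k] (P' →ₗ[A] P) :=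
    { toFun := fun x => x.1 ∘ₗ p - f ∘ₗ x.2
      map_add' := fun x y => by ext; simp; abel
      map_smul' := fun c x => by
        ext; simp [smul_sub, LinearMap.map_smul_of_tower] }
  let C (b : P' →ₗ[A] P') : (P' →ₗ[A] P) →ₗ[k] (P' →ₗ[A] P) :=
    { toFun := fun f => f ∘ₗ b
      map_add' := fun _ _ => rfl
      map_smul' := fun _ _ => rfl }
  have hL x (φ : Module.Dual k (P' →ₗ[A] P)) : (fun f => φ (L f x)) ∈
      polyFunctions k (P' →ₗ[A] P) := by
    have : (fun f => φ (L f x)) = fun f => φ (x.1 ∘ₗ p) - (φ ∘ₗ C x.2) f := by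
      ext f; simp [L, C]
    rw [this]
    exact sub_mem (polyFunctions.const _) (polyFunctions.linear _)
  have hsurj : Function.Surjective (L p) := fun f => by
    obtain ⟨g, hg⟩ := hM.exists_extension p π hp hex hπ (π ∘ₗ f)
    -- `π ∘ f` extends along `p` to `P → M` and lifts to `a : P → P`; then `a ∘ p - f` has values in
    -- the kernel of `π`, so it factors through `p`.
    obtain ⟨a, ha⟩ := Module.projective_lifting_property π g hπ
    have hker (y : P') : (a ∘ₗ p - f) y ∈ LinearMap.range p := by
      rw [← hex.linearMap_ker_eq, LinearMap.mem_ker, LinearMap.sub_apply, map_sub, sub_eq_zero]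
      exact (LinearMap.congr_fun ha (p y)).trans (LinearMap.congr_fun hg y)
    obtain ⟨b, hb⟩ := Module.projective_lifting_property p.rangeRestrict
      ((a ∘ₗ p - f).codRestrict _ hker) p.surjective_rangeRestrict
    refine ⟨(a, b), ?_⟩
    ext y
    have h : p (b y) = a (p y) - f y := congrArg Subtype.val (LinearMap.congr_fun hb y)
    change a (p y) - p (b y) = f y
    rw [h, sub_sub_cancel]
  -- The open condition on `(a, b)` is that `det a * det b ≠ 0`.
  obtain ⟨h, hh, hhp, hsol⟩ := exists_polyFunction_kernel L hL hsurj
    (x₀ := (LinearMap.id, LinearMap.id))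
    (by ext; simp [L])
    (mul_mem
      (polyFunctions.linearMap_det (LinearMap.restrictScalarsₗ k A P P k ∘ₗ LinearMap.fst _ _ _))
      (polyFunctions.linearMap_det (LinearMap.restrictScalarsₗ k A P' P' k ∘ₗ LinearMap.snd _ _ _)))
    (by
      have h1 : (LinearMap.id : P →ₗ[A] P).restrictScalars k = LinearMap.id := rfl
      have h2 : (LinearMap.id : P' →ₗ[A] P').restrictScalars k = LinearMap.id := rfl
      simp [h1, h2])
  refine ⟨_, polyFunctions.isOpen hh, hhp, fun f hf => ?_⟩
  obtain ⟨⟨α, β⟩, hαβ, hdet⟩ := hsol f hf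
  obtain ⟨h1, h2⟩ := mul_ne_zero_iff.1 hdet
  let α' := LinearEquiv.ofBijective α (LinearMap.bijective_of_det_restrictScalars_ne_zero h1)
  let β' := LinearEquiv.ofBijective β (LinearMap.bijective_of_det_restrictScalars_ne_zero h2)
  have hcomm (y : P') : α' (p y) = f (β' y) := LinearMap.congr_fun (sub_eq_zero.1 hαβ) y
  refine ⟨fun x y hxy => ?_, ⟨?_⟩⟩
  · obtain ⟨x, rfl⟩ := β'.surjective x
    obtain ⟨y, rfl⟩ := β'.surjective y
    rw [← hcomm, ← hcomm] at hxy
    rw [hp (α'.injective hxy)]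
  · refine (Submodule.Quotient.equiv _ _ α' ?_).symm ≪≫ₗ Submodule.quotEquivOfEq _ _
      hex.linearMap_ker_eq.symm ≪≫ₗ π.quotKerEquivOfSurjective hπ
    rw [← LinearMap.range_comp]
    have : (α' : P →ₗ[A] P) ∘ₗ p = f ∘ₗ (β' : P' →ₗ[A] P') := LinearMap.ext hcomm
    rw [this, LinearMap.range_comp_of_range_eq_top _ (LinearEquiv.range β')]

/-! ### Path algebras: finiteness, generators and relations -/

theorem Quiver.NoOrientedCycles.finite_paths {V : Type*} [Quiver V] [Finite V]
    [∀ i j : V, Finite (i ⟶ j)] (hV : Quiver.NoOrientedCycles V) :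
    Finite (Σ a b : V, Quiver.Path a b) := by
  -- Induction on the end point `b`, along the order `c < b` if there is a path of positive length
  -- from `c` to `b`.
  let lt : V → V → Prop := fun c b => ∃ p : Quiver.Path c b, p.length ≠ 0
  have : IsTrans V lt := ⟨fun x y z ⟨p, hp⟩ ⟨q, hq⟩ => ⟨p.comp q, by simp [hp]⟩⟩
  have : Std.Irrefl lt := ⟨fun x ⟨p, hp⟩ => hp (hV x p)⟩
  have hwf : WellFounded lt := Finite.wellFounded_of_trans_of_irrefl lt
  have key (b : V) : ∀ c : V, Finite (Quiver.Path c b) := by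
    induction b using hwf.induction with
    | h b ih =>
      intro c
      have (x : V) : Finite (Quiver.Path c x × (x ⟶ b)) := by
        by_cases hx : Nonempty (x ⟶ b)
        · have := ih x ⟨hx.some.toPath, by simp⟩ c
          infer_instance
        · rw [not_nonempty_iff] at hx
          infer_instance
      let F : Quiver.Path c b → Option (Σ x : V, Quiver.Path c x × (x ⟶ b))
        | .nil => none
        | .cons p e => some ⟨_, p, e⟩
      refine Finite.of_injective F fun p q h => ?_
      cases p <;> cases q <;> simp [F] at h ⊢
      obtain ⟨rfl, h⟩ := h
      simpa using h
  have := key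
  infer_instance

theorem PathAlgebra.finite {k V : Type*} [Field k] [Quiver V] [DecidableEq V] [Fintype V]
    [∀ i j : V, Finite (i ⟶ j)] (hV : Quiver.NoOrientedCycles V) :
    Module.Finite k (PathAlgebra k V) := by
  have := hV.finite_paths
  exact Module.Finite.of_basis (PathAlgebra.basis k)

namespace PathAlgebra
section Lift
variable {k V B : Type*} [Field k] [Quiver V] [Ring B] [Algebra k B]
  (e : V → B) (x : ∀ i j : V, (i ⟶ j) → B)

/-- The value of a path in an algebra in which a value `e i` is assigned to each vertex and a value
`x i j α` to each arrow: the product of the values of its arrows, the last arrow leftmost, times the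
value of its starting vertex. -/
def pathValue {i : V} : ∀ {j : V}, Quiver.Path i j → B
  | _, .nil => e i
  | _, .cons p α => x _ _ α * pathValue p

variable {e x}

theorem vertexValue_mul_pathValue (he : ∀ i, e i * e i = e i)
    (hl : ∀ i j α, e j * x i j α = x i j α)
    {i j : V} (p : Quiver.Path i j) : e j * pathValue e x p = pathValue e x p := by
  cases p with
  | nil => exact he _
  | cons p α => rw [pathValue, ← mul_assoc, hl]

theorem pathValue_mul_vertexValue (he : ∀ i, e i * e i = e i)
    {i j : V} (p : Quiver.Path i j) : pathValue e x p * e i = pathValue e x p := by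
  induction p with
  | nil => exact he _
  | cons p α ih => rw [pathValue, mul_assoc, ih]

theorem pathValue_comp (he : ∀ i, e i * e i = e i) (hl : ∀ i j α, e j * x i j α = x i j α)
    {i j l : V} (p : Quiver.Path i j) (q : Quiver.Path j l) :
    pathValue e x (p.comp q) = pathValue e x q * pathValue e x p := by
  induction q with
  | nil => exact (vertexValue_mul_pathValue he hl p).symm
  | cons q α ih => rw [Quiver.Path.comp_cons, pathValue, ih, pathValue, mul_assoc]

/-- The existence half of the universal property of the path algebra: values in an algebra extend
from the vertices and arrows to an algebra homomorphism if the vertices go to orthogonal idempotents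
with sum `1` which fix the values of the arrows on either side. -/
theorem exists_algHom [DecidableEq V] [Fintype V] (he : ∀ i, e i * e i = e i)
    (hne : ∀ i j, i ≠ j → e i * e j = 0) (hone : ∑ i, e i = 1)
    (hl : ∀ i j α, e j * x i j α = x i j α) (hr : ∀ i j α, x i j α * e i = x i j α) :
    ∃ F : PathAlgebra k V →ₐ[k] B, (∀ i, F (vertex k i) = e i) ∧
      ∀ i j (α : i ⟶ j), F (ofPath k α.toPath) = x i j α := by
  let F : PathAlgebra k V →ₗ[k] B := (basis k).constr k fun p => pathValue e x p.2.2
  have hF {i j : V} (p : Quiver.Path i j) : F (ofPath k p) = pathValue e x p := by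
    simp only [F, ofPath, Module.Basis.constr_basis]
  refine ⟨AlgHom.ofLinearMap F ?_ ?_, fun i => hF _, fun i j α => (hF _).trans (hr i j α)⟩
  · rw [one_def, map_sum, ← hone]
    exact Finset.sum_congr rfl fun i _ => hF _
  · intro y z
    suffices h : F ∘ₗ (mulLin k).flip z = LinearMap.mulRight k (F z) ∘ₗ F from
      LinearMap.congr_fun h y
    refine linearMap_ext fun a b q => ?_
    suffices h : F ∘ₗ mulLin k (ofPath k q) = LinearMap.mulLeft k (F (ofPath k q)) ∘ₗ F from
      LinearMap.congr_fun h z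
    refine linearMap_ext fun i j p => ?_
    change F (ofPath k q * ofPath k p) = F (ofPath k q) * F (ofPath k p)
    rw [hF, hF]
    by_cases h : j = a
    · subst h
      rw [ofPath_mul_comp, hF, pathValue_comp he hl]
    · rw [ofPath_mul_of_ne _ _ _ h, map_zero, ← pathValue_mul_vertexValue he q,
        ← vertexValue_mul_pathValue he hl p, mul_assoc, ← mul_assoc (e a), hne _ _ (Ne.symm h),
        zero_mul, mul_zero]

end Lift

variable {k V : Type*} [Field k] [Quiver V] [DecidableEq V]

theorem vertex_mul_self (i : V) : vertex k i * vertex k i = vertex k i :=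
  ofPath_mul_comp k _ _

theorem vertex_mul_of_ne {i j : V} (h : i ≠ j) : vertex k i * vertex k j = 0 :=
  ofPath_mul_of_ne k _ _ h.symm

theorem vertex_mul_arrow {i j : V} (α : i ⟶ j) :
    vertex k j * ofPath k α.toPath = ofPath k α.toPath :=
  ofPath_mul_comp k _ _

theorem arrow_mul_vertex {i j : V} (α : i ⟶ j) :
    ofPath k α.toPath * vertex k i = ofPath k α.toPath :=
  (ofPath_mul_comp k _ _).trans (by rw [Quiver.Path.nil_comp])

variable [Fintype V]

theorem sum_vertex_smul {M : Type*} [AddCommGroup M] [Module (PathAlgebra k V) M] (m : M) :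
    ∑ i : V, vertex k i • m = m := by
  rw [← Finset.sum_smul, ← one_def k (V := V), one_smul]

/-- The path algebra is generated by the vertices and the arrows. -/
theorem induction_on {P : PathAlgebra k V → Prop} (y : PathAlgebra k V) (zero : P 0)
    (add : ∀ y z, P y → P z → P (y + z)) (smul : ∀ (s : k) y, P y → P (s • y))
    (mul : ∀ y z, P y → P z → P (y * z)) (vertex : ∀ i, P (vertex k i))
    (arrow : ∀ {i j : V} (α : i ⟶ j), P (ofPath k α.toPath)) : P y := by
  have hp {i j : V} (p : Quiver.Path i j) : P (ofPath k p) := by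
    induction p with
    | nil => exact vertex i
    | cons p α ih =>
      rw [← Quiver.Path.comp_toPath_eq_cons, ← ofPath_mul_comp]
      exact mul _ _ (arrow α) ih
  induction (basis k).mem_span y using Submodule.span_induction with
  | mem y hy =>
    obtain ⟨p, rfl⟩ := hy
    exact hp p.2.2
  | zero => exact zero
  | add y z _ _ hy hz => exact add y z hy hz
  | smul s y _ hy => exact smul s y hy

end PathAlgebra

/-! ### Modules over the path algebra and representations -/

open PathAlgebra

section
variable {k V : Type*} [Field k] [Quiver V] [DecidableEq V] [Fintype V]

/-- A module is isomorphic to the module of a representation `R` as soon as a linear isomorphism is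
compatible with the vertices and the arrows. -/
theorem RepSpace.nonempty_equiv {d : V → ℕ} (R : RepSpace k V d) {M : Type*} [AddCommGroup M]
    [Module k M] [Module (PathAlgebra k V) M] [IsScalarTower k (PathAlgebra k V) M]
    (T : M ≃ₗ[k] ∀ i, Fin (d i) → k) (hT : ∀ i m, T (vertex k i • m) = Pi.single i (T m i))
    (hα : ∀ i j (α : i ⟶ j) m, T (ofPath k α.toPath • m) = Pi.single j (R i j α (T m i))) :
    Nonempty (R.ModuleOf ≃ₗ[PathAlgebra k V] M) := by
  have hp {i j : V} (p : Quiver.Path i j) (m : M) :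
      T (ofPath k p • m) = R.pathEnd p (T m) := by
    induction p with
    | nil => exact hT _ _
    | cons p α ih =>
      rw [← Quiver.Path.comp_toPath_eq_cons, ← ofPath_mul_comp, mul_smul, hα, ih]
      simp [pathEnd, mapPath, Quiver.Path.comp_toPath_eq_cons]
  have hx (x : PathAlgebra k V) (m : M) : T (x • m) = R.action x (T m) := by
    suffices h : T.toLinearMap ∘ₗ (Algebra.lsmul k k M).toLinearMap.flip m =
        R.action.toLinearMap.flip (T m) from LinearMap.congr_fun h x
    refine linearMap_ext fun i j p => ?_
    refine (hp p m).trans ?_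
    simp only [action, LinearMap.flip_apply, AlgHom.toLinearMap_apply, AlgHom.ofLinearMap_apply,
      ofPath, Module.Basis.constr_basis]
  exact ⟨LinearEquiv.symm
    { T.toAddEquiv with
      map_smul' := hx }⟩

/-- The decomposition `M = ⨁ i, e_i M` in coordinates. -/
theorem exists_equiv_pi_dimVector (M : Type*) [AddCommGroup M]
    [Module k M] [Module (PathAlgebra k V) M] [IsScalarTower k (PathAlgebra k V) M]
    [Module.Finite k M] :
    ∃ T : M ≃ₗ[k] ∀ i, Fin (dimVector k (V := V) M i) → k,
      ∀ i m, T (vertex k i • m) = Pi.single i (T m i) := by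
  let ρ (i : V) : M →ₗ[k] M := Algebra.lsmul k k M (vertex k i)
  let φ (i : V) : LinearMap.range (ρ i) ≃ₗ[k] (Fin (dimVector k (V := V) M i) → k) :=
    (Module.finBasis k _).equivFun
  have hmem (i j : V) (y : LinearMap.range (ρ i)) :
      vertex k j • (y : M) = if j = i then (y : M) else 0 := by
    obtain ⟨_, m, rfl⟩ := y
    change vertex k j • vertex k i • m = if j = i then vertex k i • m else 0
    rw [← mul_smul]
    split_ifs with h
    · rw [h, vertex_mul_self]
    · rw [vertex_mul_of_ne h, zero_smul]
  let T : M →ₗ[k] ∀ i, Fin (dimVector k (V := V) M i) → k :=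
    LinearMap.pi fun i => (φ i).toLinearMap ∘ₗ (ρ i).rangeRestrict
  have hT (m : M) (i : V) : T m i = φ i ⟨vertex k i • m, m, rfl⟩ := rfl
  have hbij : Function.Bijective T := by
    constructor
    · rw [injective_iff_map_eq_zero]
      intro m hm
      rw [← sum_vertex_smul (k := k) (V := V) m]
      refine Finset.sum_eq_zero fun i _ => ?_
      have := congrFun hm i
      rw [hT, Pi.zero_apply, LinearEquiv.map_eq_zero_iff] at this
      exact congrArg Subtype.val this
    · intro y
      refine ⟨∑ i, ((φ i).symm (y i) : M), ?_⟩
      ext1 j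
      have hs : vertex k j • ∑ i, ((φ i).symm (y i) : M) = (φ j).symm (y j) := by
        rw [Finset.smul_sum, Finset.sum_eq_single j]
        · rw [hmem, if_pos rfl]
        · intro i _ hi
          rw [hmem, if_neg hi.symm]
        · simp
      rw [hT]
      exact (φ j).eq_symm_apply.1 (Subtype.ext hs)
  refine ⟨LinearEquiv.ofBijective T hbij, fun i m => ?_⟩
  ext1 j
  change T _ j = _
  by_cases h : j = i
  · subst h
    rw [Pi.single_eq_same, LinearEquiv.ofBijective_apply, hT, hT]
    simp only [← mul_smul, vertex_mul_self]
  · rw [Pi.single_eq_of_ne h, hT]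
    simp only [← mul_smul, vertex_mul_of_ne h, zero_smul]
    exact map_zero (φ j)

end

/-! ### Rigid modules in the representation space -/

section Cocycle
variable {k : Type u} {V : Type v} [Field k] [Quiver.{a} V] [DecidableEq V] [Fintype V]
  {M : Type (max u v a)} [AddCommGroup M] [Module k M] [Module (PathAlgebra k V) M]
  [IsScalarTower k (PathAlgebra k V) M]

/-- Let `c` be a family of maps `e_i M → e_j M`, one for every arrow `i ⟶ j`. It defines an
extension of `M` by `M`, and this extension splits if `M` is rigid, which says that `c` is the
commutator of the arrows with a linear endomorphism of `M`. -/
theorem IsRigidModule.exists_commutator (hM : IsRigidModule (PathAlgebra k V) M)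
    (c : ∀ i j : V, (i ⟶ j) → Module.End k M)
    (hl : ∀ i j α m, vertex k j • c i j α m = c i j α m)
    (hr : ∀ i j α m, c i j α (vertex k i • m) = c i j α m) :
    ∃ g : Module.End k M, ∀ i j (α : i ⟶ j) m,
      c i j α m = ofPath k α.toPath • g m - g (ofPath k α.toPath • m) := by
  let ρ : PathAlgebra k V →ₐ[k] Module.End k M := Algebra.lsmul k k M
  let e (i : V) : Module.End k (M × M) := (ρ (vertex k i)).prodMap (ρ (vertex k i))
  -- On the extension `M × M` an arrow `α` acts by `(m, n) ↦ (α m + c n, α n)`.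
  let x (i j : V) (α : i ⟶ j) : Module.End k (M × M) :=
    (ρ (ofPath k α.toPath)).prodMap (ρ (ofPath k α.toPath)) +
      LinearMap.inl k M M ∘ₗ c i j α ∘ₗ LinearMap.snd k M M
  have hρ (y : PathAlgebra k V) (m : M) : ρ y m = y • m := rfl
  obtain ⟨F, hFe, hFx⟩ := exists_algHom (k := k) (e := e) (x := x)
    (fun i => by
      refine LinearMap.ext fun m => ?_
      simp only [e, Module.End.mul_apply, LinearMap.prodMap_apply, hρ, ← mul_smul, vertex_mul_self])
    (fun i j h => by
      refine LinearMap.ext fun m => ?_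
      simp [e, Module.End.mul_apply, LinearMap.prodMap_apply, hρ, ← mul_smul, vertex_mul_of_ne h])
    (by
      refine LinearMap.ext fun m => ?_
      simp only [e, LinearMap.sum_apply, LinearMap.prodMap_apply, hρ]
      ext
      · simp [Prod.fst_sum, sum_vertex_smul]
      · simp [Prod.snd_sum, sum_vertex_smul])
    (fun i j α => by
      refine LinearMap.ext fun m => ?_
      simp [e, x, hρ, ← mul_smul, vertex_mul_arrow, hl])
    (fun i j α => by
      refine LinearMap.ext fun m => ?_
      simp [e, x, hρ, ← mul_smul, arrow_mul_vertex, hr])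
  have hFall (y : PathAlgebra k V) : (∀ m, F y (m, 0) = (y • m, 0)) ∧
      ∀ m, (F y m).2 = y • m.2 := by
    induction y using PathAlgebra.induction_on with
    | zero => exact ⟨fun m => Prod.ext (by simp) (by simp), by simp⟩
    | add y z hy hz => simp [hy.1, hz.1, hy.2, hz.2, add_smul]
    | smul s y hy => simp [hy.1, hy.2]
    | mul y z hy hz => simp [hy.1, hz.1, hy.2, hz.2, mul_smul]
    | vertex i => simp [hFe, e, hρ]
    | arrow α => simp [hFx, x, hρ]
  let : Module (PathAlgebra k V) (M × M) := Module.compHom (M × M) F.toRingHom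
  let ι : M →ₗ[PathAlgebra k V] M × M :=
    { toFun := fun m => (m, 0)
      map_add' := by simp
      map_smul' := fun y m => ((hFall y).1 m).symm }
  let π : M × M →ₗ[PathAlgebra k V] M :=
    { toFun := Prod.snd
      map_add' := by simp
      map_smul' := fun y m => (hFall y).2 m }
  obtain ⟨r, hr'⟩ := hM.exists_extension ι π (fun m n h => congrArg Prod.fst h)
    (fun m => ⟨fun h => ⟨m.1, Prod.ext rfl h.symm⟩, by rintro ⟨n, rfl⟩; rfl⟩)
    (fun m => ⟨(0, m), rfl⟩) LinearMap.id
  have hrF (y : PathAlgebra k V) (m : M × M) : r (F y m) = y • r m := r.map_smul y m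
  have hrι (m : M) : r (m, 0) = m := LinearMap.congr_fun hr' m
  -- The retraction `r` on the second summand; its failure to be a homomorphism is measured by `c`.
  let g : Module.End k M :=
    { toFun := fun m => r (0, m)
      map_add' := fun m n => by rw [← map_add]; simp
      map_smul' := fun s m => by
        have h := hrF (algebraMap k (PathAlgebra k V) s) (0, m)
        rw [AlgHom.commutes, Module.algebraMap_end_apply, algebraMap_smul] at h
        simpa using h }
  have hg (m : M) : g m = r (0, m) := rfl
  refine ⟨g, fun i j α m => ?_⟩
  rw [hg, hg, ← hrF, hFx, ← map_sub]
  simp [x, hρ, hrι]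

/-- The second half of the theorem, with `M` identified with `⨁ i, k^{d i}` through `T`. If `R₀` is
the representation obtained from `M`, an isomorphism from `R₀` to `R` is a family `γ` of
automorphisms of the spaces `k^{d i}` with `γ j ∘ R₀ α = R α ∘ γ i` for all arrows `α : i ⟶ j`. These
equations are linear in `γ`, and at `R = R₀` they are independent because `M` is rigid. -/
theorem IsRigidModule.exists_dense_isOpen_equiv [Infinite k] [∀ i j : V, Finite (i ⟶ j)]
    (hM : IsRigidModule (PathAlgebra k V) M) {d : V → ℕ} (T : M ≃ₗ[k] ∀ i, Fin (d i) → k)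
    (hT : ∀ i m, T (vertex k i • m) = Pi.single i (T m i)) :
    ∃ U : Set (RepSpace k V d), IsOpen[zariskiTopology k (RepSpace k V d)] U ∧
      @Dense _ (zariskiTopology k (RepSpace k V d)) U ∧
      ∀ R ∈ U, Nonempty (R.ModuleOf ≃ₗ[PathAlgebra k V] M) := by
  have hTs i (v : Fin (d i) → k) :
      vertex k i • T.symm (Pi.single i v) = T.symm (Pi.single i v) := by
    apply T.injective
    simp [hT]
  have hfix i (m : M) (h : vertex k i • m = m) : T m = Pi.single i (T m i) := by
    rw [← hT, h]
  let R₀ : RepSpace k V d := fun i j α =>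
    LinearMap.proj j ∘ₗ T.toLinearMap ∘ₗ Algebra.lsmul k k M (ofPath k α.toPath) ∘ₗ
      T.symm.toLinearMap ∘ₗ LinearMap.single k (fun i => Fin (d i) → k) i
  have hR₀ i j (α : i ⟶ j) (m : M) :
      T (ofPath k α.toPath • m) = Pi.single j (R₀ i j α (T m i)) := by
    rw [hfix j (ofPath k α.toPath • m) (by rw [← mul_smul, vertex_mul_arrow])]
    congr 1
    simp [R₀, ← hT, ← mul_smul, arrow_mul_vertex]
  let L (R : RepSpace k V d) : (∀ i, Module.End k (Fin (d i) → k)) →ₗ[k] RepSpace k V d :=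
    LinearMap.pi fun i => LinearMap.pi fun j => LinearMap.pi fun α =>
      LinearMap.lcomp k _ (R₀ i j α) ∘ₗ LinearMap.proj j -
        LinearMap.llcomp k _ _ _ (R i j α) ∘ₗ LinearMap.proj i
  have hLapp R γ i j α : L R γ i j α = γ j ∘ₗ R₀ i j α - R i j α ∘ₗ γ i := rfl
  have hL γ (φ : Module.Dual k (RepSpace k V d)) : (fun R => φ (L R γ)) ∈
      polyFunctions k (RepSpace k V d) := by
    let C₀ : RepSpace k V d := fun i j α => γ j ∘ₗ R₀ i j α
    let C : RepSpace k V d →ₗ[k] RepSpace k V d :=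
      { toFun := fun R i j α => R i j α ∘ₗ γ i
        map_add' := fun _ _ => rfl
        map_smul' := fun _ _ => rfl }
    have : (fun R => φ (L R γ)) = fun R => φ C₀ - (φ ∘ₗ C) R := by
      ext R
      rw [LinearMap.comp_apply, ← map_sub]
      rfl
    rw [this]
    exact sub_mem (polyFunctions.const _) (polyFunctions.linear _)
  have hsurj : Function.Surjective (L R₀) := fun c => by
    -- The commutator in `exists_commutator` has the sign opposite to that of `L`; hence `-c`.
    obtain ⟨g, hg⟩ := hM.exists_commutator (fun i j α =>
      T.symm.toLinearMap ∘ₗ LinearMap.single k (fun i => Fin (d i) → k) j ∘ₗ (-c i j α) ∘ₗ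
        LinearMap.proj i ∘ₗ T.toLinearMap) (fun i j α m => hTs _ _)
        (fun i j α m => by simp [hT])
    refine ⟨fun i => LinearMap.proj i ∘ₗ T.toLinearMap ∘ₗ g ∘ₗ
      T.symm.toLinearMap ∘ₗ LinearMap.single k (fun i => Fin (d i) → k) i, ?_⟩
    ext1 i; ext1 j; ext1 α
    refine LinearMap.ext fun v => ?_
    have h := congrArg (fun m => T m j) (hg i j α (T.symm (Pi.single i v)))
    have h1 : T (ofPath k α.toPath • T.symm (Pi.single i v)) = Pi.single j (R₀ i j α v) := by
      rw [hR₀]; simp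
    have h2 : T (ofPath k α.toPath • g (T.symm (Pi.single i v))) j =
        R₀ i j α (T (g (T.symm (Pi.single i v))) i) := by
      rw [hR₀]; simp
    rw [← T.symm_apply_eq.2 h1.symm] at h
    simp only [map_sub, Pi.sub_apply, h2] at h
    simp at h
    rw [hLapp]
    simp only [LinearMap.sub_apply, LinearMap.comp_apply, LinearMap.proj_apply,
      LinearEquiv.coe_coe, LinearMap.single_apply]
    rw [← neg_sub, ← h, neg_neg]
  -- The open condition on `γ` is that the product of the determinants of the `γ i` is not zero.
  obtain ⟨h, hh, hhp, hsol⟩ := exists_polyFunction_kernel L hL hsurj (x₀ := fun _ => LinearMap.id)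
    (by ext1 i; ext1 j; ext1 α; rw [hLapp]; simp)
    (polyFunctions.prod Finset.univ fun i _ => polyFunctions.linearMap_det
      (LinearMap.proj (φ := fun i => Module.End k (Fin (d i) → k)) i))
    (by simp)
  refine ⟨_, polyFunctions.isOpen hh, polyFunctions.dense hh hhp, fun R hR => ?_⟩
  obtain ⟨γ, hγ, hdet⟩ := hsol R hR
  rw [Finset.prod_ne_zero_iff] at hdet
  let Γ (i : V) := LinearMap.equivOfDetNeZero (γ i) (hdet i (Finset.mem_univ i))
  have hΓ i v : Γ i v = γ i v := rfl
  refine R.nonempty_equiv (T ≪≫ₗ LinearEquiv.piCongrRight Γ) (fun i m => ?_) fun i j α m => ?_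
  · ext1 l
    by_cases hl : l = i
    · subst hl; simp [hT]
    · simp [hT, hl]
  · have hcomm := LinearMap.congr_fun
      (sub_eq_zero.1 (congrFun (congrFun (congrFun hγ i) j) α)) (T m i)
    ext1 l
    by_cases hl : l = j
    · subst hl; simpa [hR₀, hΓ] using hcomm
    · simp [hR₀, hl]

end Cocycle

/-! ### The theorem -/

theorem mainTheorem1 {k : Type u} [Field k] [IsAlgClosed k]
    {V : Type v} [Quiver.{a} V] [DecidableEq V] [Fintype V] [∀ i j : V, Finite (i ⟶ j)]
    (hV : Quiver.NoOrientedCycles V)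
    {M : Type (max u v a)} [AddCommGroup M] [Module k M] [Module (PathAlgebra k V) M]
    [IsScalarTower k (PathAlgebra k V) M] [Module.Finite (PathAlgebra k V) M]
    (hM : IsRigidModule (PathAlgebra k V) M) :
    (∀ {P' P : Type (max u v a)}
      [AddCommGroup P'] [Module k P'] [Module (PathAlgebra k V) P']
      [IsScalarTower k (PathAlgebra k V) P'] [Module.Finite (PathAlgebra k V) P']
      [Module.Projective (PathAlgebra k V) P']
      [AddCommGroup P] [Module k P] [Module (PathAlgebra k V) P]
      [IsScalarTower k (PathAlgebra k V) P] [Module.Finite (PathAlgebra k V) P]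
      [Module.Projective (PathAlgebra k V) P]
      (p : P' →ₗ[PathAlgebra k V] P) (π : P →ₗ[PathAlgebra k V] M),
      Function.Injective p → Function.Exact p π → Function.Surjective π →
      ∃ U : Set (P' →ₗ[PathAlgebra k V] P),
        IsOpen[zariskiTopology k (P' →ₗ[PathAlgebra k V] P)] U ∧ p ∈ U ∧
        ∀ f ∈ U, Function.Injective f ∧
          Nonempty ((P ⧸ LinearMap.range f) ≃ₗ[PathAlgebra k V] M)) ∧
    (∃ U : Set (RepSpace k V (dimVector k (V := V) M)),
      IsOpen[zariskiTopology k (RepSpace k V (dimVector k (V := V) M))] U ∧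
      @Dense _ (zariskiTopology k (RepSpace k V (dimVector k (V := V) M))) U ∧
      ∀ R ∈ U, Nonempty (R.ModuleOf ≃ₗ[PathAlgebra k V] M)) := by
  have := PathAlgebra.finite (k := k) hV
  refine ⟨?_, ?_⟩
  · intro P' P _ _ _ _ _ _ _ _ _ _ _ _ p π hp hex hπ
    have : Module.Finite k P' := Module.Finite.trans (PathAlgebra k V) P'
    have : Module.Finite k P := Module.Finite.trans (PathAlgebra k V) P
    exact hM.exists_isOpen_coker_equiv p π hp hex hπ
  · have : Module.Finite k M := Module.Finite.trans (PathAlgebra k V) M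
    obtain ⟨T, hT⟩ := exists_equiv_pi_dimVector (k := k) (V := V) M
    exact hM.exists_dense_isOpen_equiv T hT
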